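/- Let $X$ be a finite cell complex with set of $k$-cells $X_k$, given by its augmented integral cellular chain complex: $C_k=\mathbb Z^{X_k}$ for $k\ge 0$, $C_{-1}=\mathbb Z$, integer boundary matrices $\partial_k:C_k\to C_{k-1}$ with $\partial_{k}\partial_{k+1}=0$, where $\partial_0(v)=1$ for every vertex $v$ and $\partial_{-1}=0$. Write $Z_k=\ker\partial_k$, $B_k=\operatorname{im}\partial_{k+1}$, $\widetilde H_k(X)=Z_k/B_k$, $\delta_k=\partial_{k+1}^t$ and $Z^k=\ker\delta_k$. Let $i\ge 0$ and assume the unicycle condition $$\operatorname{rk}\widetilde H_{i+1}(X)=0,\qquad \operatorname{rk}\widetilde H_i(X)=1,\qquad \operatorname{rk}\widetilde H_{i-1}(X)=0 .$$ Let $\mathcal S_i$ be the set of subcomplexes $Y$ with $X^{i-1}\subseteq Y\subseteq X^i$ (where $X^j$ is the $j$-skeleton), let $I(Y)\subseteq X_i$ be the set of $i$-cells of $Y$, and let $\overline Y\in\mathcal S_i$ be the subcomplex with $I(\overline Y)=X_i\setminus I(Y)$. An $i$-cycletree is a $U\in\mathcal S_i$ with $|I(U)|=\operatorname{rk}Z_{i-1}+1$;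 its weight $\operatorname{wt}(U)$ is $|\widetilde H_{i-1}(U)|$ if this is finite, and $0$ otherwise. An $i$-dimensional dual spanning tree is a $T^*\in\mathcal S_i$ with $|I(T^*)|=\operatorname{rk}Z^{i+1}$; its weight is $\operatorname{wt}(T^*)=|\det M|$, where the columns of $M$ are the coordinates of $\delta_i(\sigma)$, $\sigma\in I(T^*)$, with respect to a $\mathbb Z$-basis of $Z^{i+1}$. For an $i$-cycletree $U$ let $n=\operatorname{rk}Z_{i-1}$, fix a $\mathbb Z$-basis of $Z_{i-1}$ and an enumeration $\sigma_1,\dots,\sigma_{n+1}$ of $I(U)$, and let $A$ be the $n\times(n+1)$ matrix whose $j$-th column is the coordinate vector of $\partial_i\sigma_j$. Put $C_U=\sum_{j}(-1)^j\det([A]_j)\,\sigma_j\in Z_i$, where $[A]_j$ is $A$ without its $j$-th column, and let $\widehat{C_U}=C_U/\gcd(C_U)$, where $\gcd(C_U)$ is the gcd of the components of $C_U$ ($\widehat{C_U}=0$ if $C_U=0$). For $z\in Z_i$ the winding number is $w(z)=\det([z],[b_1],\dots,[b_m])$, where $b_1,\dots,b_m$ is a $\mathbb Z$-basis of $B_i$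 and $[\cdot]$ denotes coordinates with respect to a $\mathbb Z$-basis of $Z_i$ (here $\operatorname{rk}Z_i=m+1$). Then $U\mapsto\overline U$ is a bijection from the set of $i$-cycletrees onto the set of $i$-dimensional dual spanning trees. Moreover, for every $i$-cycletree $U$, with $T^*=\overline U$, and for all choices of the bases and enumerations, $$|w(C_U)|=\operatorname{wt}(U)\,|w(\widehat{C_U})|=\operatorname{wt}(T^*)\,|\widetilde H_{i-1}(X)| .$$ -/

import Mathlib

open Module Matrix

universe u

/-- A finite complex: finite sets of `k`-cells for `k = 0, 1, …, dim` (none above `dim`) with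
integer boundary matrices. `bd k` is the matrix of `∂_{k+1} : C_{k+1} → C_k`.  The last axiom says
that `∂_0 ∂_1 = 0` for the augmentation `∂_0 : C_0 → C_{-1} = ℤ`, `∂_0 v = 1`. -/
structure FinCellComplex where
  dim : ℕ
  Cell : ℕ → Type u
  [fintypeCell : ∀ k, Fintype (Cell k)]
  [decEqCell : ∀ k, DecidableEq (Cell k)]
  isEmpty_of_lt : ∀ k, dim < k → IsEmpty (Cell k)
  bd : ∀ k, Matrix (Cell k) (Cell (k + 1)) ℤ
  bd_mul_bd : ∀ k, bd k * bd (k + 1) = 0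
  sum_bd_zero : ∀ e : Cell 1, ∑ v, bd 0 v e = 0

namespace FinCellComplex

attribute [instance] fintypeCell decEqCell

variable (X : FinCellComplex.{u})

/-! ### The augmented chain complex

Everything about the augmented complex is indexed with a shift by one, so that natural numbers
suffice: index `k` stands for dimension `k - 1`. -/

/-- The generators of `C_{k-1}`: the empty cell for `k = 0`, the `(k-1)`-cells for `k ≥ 1`. -/
def Face : ℕ → Type u
  | 0 => PUnit
  | k + 1 => X.Cell k

/-- A `k`-cell as a generator of `C_k`. -/
def toFace {X : FinCellComplex.{u}} {k : ℕ} (σ : X.Cell k) : X.Face (k + 1) := σ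

instance : ∀ k, Fintype (X.Face k)
  | 0 => inferInstanceAs (Fintype PUnit)
  | k + 1 => X.fintypeCell k

instance : ∀ k, DecidableEq (X.Face k)
  | 0 => inferInstanceAs (DecidableEq PUnit)
  | k + 1 => X.decEqCell k

/-- The chain group `C_{k-1}(X)`, which is also used as the group of cochains. -/
abbrev Chain (k : ℕ) : Type u := X.Face k → ℤ

/-- The matrix of `∂_k : C_k → C_{k-1}` for `k ≥ 0`; `∂_0` is the all-ones row. -/
def boundary : ∀ k, Matrix (X.Face k) (X.Face (k + 1)) ℤ
  | 0 => Matrix.of fun _ _ => 1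
  | k + 1 => X.bd k

theorem boundary_mul_boundary : ∀ k, X.boundary k * X.boundary (k + 1) = 0
  | 0 => by
    ext a e
    have h := X.sum_bd_zero e
    rw [Matrix.mul_apply]
    simp only [boundary, Matrix.of_apply, one_mul, Matrix.zero_apply]
    exact h
  | k + 1 => X.bd_mul_bd k

/-- The cycle group `Z_{k-1}(X) = ker ∂_{k-1}`, where `∂_{-1} = 0`. -/
def cycles : ∀ k, Submodule ℤ (X.Chain k)
  | 0 => ⊤
  | k + 1 => LinearMap.ker (X.boundary k).mulVecLin

/-- The boundary group `B_{k-1}(X) = im ∂_k`. -/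
def boundaries (k : ℕ) : Submodule ℤ (X.Chain k) :=
  LinearMap.range (X.boundary k).mulVecLin

/-- The cocycle group `Z^{k-1}(X) = ker ∂_kᵗ`. -/
def cocycles (k : ℕ) : Submodule ℤ (X.Chain k) :=
  LinearMap.ker (X.boundary k)ᵀ.mulVecLin

theorem boundaries_le_cycles : ∀ k, X.boundaries k ≤ X.cycles k
  | 0 => le_top
  | k + 1 => by
    rintro _ ⟨c, rfl⟩
    simp [cycles, Matrix.mulVec_mulVec, X.boundary_mul_boundary k]

/-- The reduced homology group `H̃_{k-1}(X) = Z_{k-1}(X) / B_{k-1}(X)`. -/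
abbrev Homology (k : ℕ) : Type u :=
  X.cycles k ⧸ (X.boundaries k).submoduleOf (X.cycles k)

/-- The boundary `∂_k σ` of a `k`-cell, as an element of `Z_{k-1}(X)`. -/
def cellBoundary (k : ℕ) (σ : X.Cell k) : X.cycles k :=
  ⟨fun τ => X.boundary k τ (toFace σ), X.boundaries_le_cycles k ⟨Pi.single (toFace σ) 1, by
    ext τ
    simp⟩⟩

/-- The coboundary `δ_k σ` of a `k`-cell, where `δ_k = ∂_{k+1}ᵗ`, as an element of
`Z^{k+1}(X)`. -/
def cellCoboundary (k : ℕ) (σ : X.Cell k) : X.cocycles (k + 2) :=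
  ⟨fun τ => X.boundary (k + 1) (toFace σ) τ, by
    ext ρ
    have h := congrFun (congrFun (X.boundary_mul_boundary (k + 1)) (toFace σ)) ρ
    rw [Matrix.mul_apply] at h
    simp only [Matrix.mulVecLin_apply, Matrix.mulVec_transpose, Matrix.vecMul, dotProduct]
    exact h⟩

/-- The unicycle condition in dimension `i`:
`rk H̃_{i+1}(X) = 0`, `rk H̃_i(X) = 1`, `rk H̃_{i-1}(X) = 0`. -/
def Unicycle (i : ℕ) : Prop :=
  finrank ℤ (X.Homology (i + 2)) = 0 ∧ finrank ℤ (X.Homology (i + 1)) = 1 ∧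
    finrank ℤ (X.Homology i) = 0

/-! ### Subcomplexes -/

/-- A set of cells that contains every cell occurring in the boundary of one of its cells. -/
@[ext]
structure Subcomplex where
  cells : ∀ k, Set (X.Cell k)
  closed : ∀ k (τ : X.Cell k) (σ : X.Cell (k + 1)), σ ∈ cells (k + 1) → X.bd k τ σ ≠ 0 →
    τ ∈ cells k

instance : PartialOrder X.Subcomplex :=
  PartialOrder.lift Subcomplex.cells fun _ _ h => Subcomplex.ext h

/-- The skeleton `X^{n-1}`, consisting of all cells of dimension less than `n`. -/
def skeletonLT (n : ℕ) : X.Subcomplex where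
  cells k := {_σ | k < n}
  closed k _ _ h _ := lt_trans (Nat.lt_succ_self k) h

/-- `𝒮_i`, the subcomplexes `Y` with `X^{i-1} ⊆ Y ⊆ X^i`. The set `I(Y)` is `Y.cells i`. -/
def spanningSubcomplexes (i : ℕ) : Set X.Subcomplex :=
  {Y | X.skeletonLT i ≤ Y ∧ Y ≤ X.skeletonLT (i + 1)}

variable {X}

namespace Subcomplex

/-- The complement `Ȳ = X^{i-1} ∪ (X_i \ I(Y))` in dimension `i`. -/
def complement (i : ℕ) (Y : X.Subcomplex) : X.Subcomplex where
  cells k := {σ | k < i ∨ (k = i ∧ σ ∉ Y.cells k)}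
  closed k _ _ h _ := Or.inl (by rcases h with h | ⟨h, -⟩ <;> omega)

/-- The chain group `C_{k-1}(Y)`, as the chains of `X` supported on `Y`. -/
def chains (Y : X.Subcomplex) : ∀ k, Submodule ℤ (X.Chain k)
  | 0 => ⊤
  | k + 1 =>
    { carrier := {c | ∀ σ : X.Cell k, σ ∉ Y.cells k → c (toFace σ) = 0}
      add_mem' := fun ha hb σ hσ => (congrArg₂ (· + ·) (ha σ hσ) (hb σ hσ)).trans (add_zero 0)
      zero_mem' := fun _ _ => rfl
      smul_mem' := fun r _ ha σ hσ => (congrArg (r • ·) (ha σ hσ)).trans (smul_zero r) }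

/-- The cycle group `Z_{k-1}(Y)`. -/
def cycles (Y : X.Subcomplex) (k : ℕ) : Submodule ℤ (X.Chain k) :=
  X.cycles k ⊓ Y.chains k

/-- The boundary group `B_{k-1}(Y) = ∂_k C_k(Y)`. -/
def boundaries (Y : X.Subcomplex) (k : ℕ) : Submodule ℤ (X.Chain k) :=
  (Y.chains (k + 1)).map (X.boundary k).mulVecLin

/-- The reduced homology group `H̃_{k-1}(Y)`. -/
abbrev Homology (Y : X.Subcomplex) (k : ℕ) : Type u :=
  Y.cycles k ⧸ (Y.boundaries k).submoduleOf (Y.cycles k)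

/-- The weight `|H̃_{i-1}(U)|` of an `i`-cycletree, and `0` if that group is infinite
(this is the convention of `Nat.card`). -/
noncomputable def weight (i : ℕ) (U : X.Subcomplex) : ℕ :=
  Nat.card (U.Homology i)

end Subcomplex

variable (X)

/-- `𝒰_i`: the members `U` of `𝒮_i` with `|I(U)| = rk Z_{i-1}(X) + 1`. -/
def cycletrees (i : ℕ) : Set X.Subcomplex :=
  {U | U ∈ X.spanningSubcomplexes i ∧ (U.cells i).ncard = finrank ℤ (X.cycles i) + 1}

/-- `𝒯^i`: the members `T` of `𝒮_i` with `|I(T)| = rk Z^{i+1}(X)`. -/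
def dualSpanningTrees (i : ℕ) : Set X.Subcomplex :=
  {T | T ∈ X.spanningSubcomplexes i ∧ (T.cells i).ncard = finrank ℤ (X.cocycles (i + 2))}

variable {X}

/-- The weight `|det [δ_i|_I]_Z|` of a dual spanning tree with `I(T) = I`, where `Z` is a basis of
`Z^{i+1}(X)` and `e` an enumeration of `I`. -/
noncomputable def dualWeight {i q : ℕ} (Z : Basis (Fin q) ℤ (X.cocycles (i + 2)))
    {I : Set (X.Cell i)} (e : Fin q ≃ I) : ℤ :=
  |(Matrix.of fun r c => Z.repr (X.cellCoboundary i (e c)) r).det|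

/-! ### The cycle part of a cycletree -/

/-- The vector of signed maximal minors of an `n × (n+1)` matrix (with the columns numbered from
`1` in the sign). -/
def minorVec {n : ℕ} (A : Matrix (Fin n) (Fin (n + 1)) ℤ) : Fin (n + 1) → ℤ :=
  fun j => (-1) ^ ((j : ℕ) + 1) * (A.submatrix id j.succAbove).det

theorem mulVec_minorVec {n : ℕ} (A : Matrix (Fin n) (Fin (n + 1)) ℤ) :
    A *ᵥ minorVec A = 0 := by
  ext r
  have h : (Matrix.of (Fin.cons (fun c => A r c) fun a c => A a c : Fin (n + 1) → Fin (n + 1) → ℤ)).det = 0 :=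
    Matrix.det_zero_of_row_eq (Fin.succ_ne_zero r).symm rfl
  rw [Matrix.det_succ_row_zero] at h
  rw [← neg_eq_zero, ← Finset.sum_neg_distrib] at h
  rw [Pi.zero_apply, ← h, Matrix.mulVec, dotProduct]
  refine Finset.sum_congr rfl fun j _ => ?_
  have : (Matrix.of (Fin.cons (fun c => A r c) fun a c => A a c : Fin (n + 1) → Fin (n + 1) → ℤ)).submatrix Fin.succ
      j.succAbove = A.submatrix id j.succAbove := by
    ext a b; simp
  rw [this]
  simp [minorVec, pow_succ]
  ring

/-- The matrix `[∂_i|_I]_Z`, where `Z` is a basis of `Z_{i-1}(X)` and `e` an enumeration of `I`. -/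
noncomputable def boundaryMatrix {i n m : ℕ} (Z : Basis (Fin n) ℤ (X.cycles i))
    {I : Set (X.Cell i)} (e : Fin m ≃ I) : Matrix (Fin n) (Fin m) ℤ :=
  Matrix.of fun r c => Z.repr (X.cellBoundary i (e c)) r

/-- The cycle part `C_U ∈ Z_i(X)` of an `i`-cycletree `U` with `I(U) = I`: the vector of signed
maximal minors of `[∂_i|_I]_Z`, extended by zero to the cells outside `I`. -/
noncomputable def cyclePart {i n : ℕ} (Z : Basis (Fin n) ℤ (X.cycles i))
    {I : Set (X.Cell i)} (e : Fin (n + 1) ≃ I) : X.cycles (i + 1) :=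
  ⟨∑ j, Pi.single (toFace (e j : X.Cell i)) (minorVec (boundaryMatrix Z e) j), by
    have h : ∑ j, minorVec (boundaryMatrix Z e) j • X.cellBoundary i (e j) = 0 := by
      apply Z.repr.injective
      ext r
      have := congrFun (mulVec_minorVec (boundaryMatrix Z e)) r
      simpa [Matrix.mulVec, dotProduct, boundaryMatrix, Finsupp.finsetSum_apply,
        mul_comm] using this
    have h' := congrArg Subtype.val h
    ext τ
    have h'' := congrFun h' τ
    simp only [map_sum, Finset.sum_apply, Matrix.mulVecLin_apply, Matrix.mulVec_single, Pi.zero_apply]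
    simpa [cellBoundary, Finset.sum_apply, mul_comm] using h''⟩

/-- The integer vector `ẑ = z / gcd(z)` for an integer cycle `z`, where `gcd(z)` is the gcd of all
components; it is `0` for `z = 0`. -/
def primitivePart {k : ℕ} (z : X.cycles (k + 1)) : X.cycles (k + 1) :=
  ⟨fun σ => z.1 σ / Finset.univ.gcd z.1, by
    obtain ⟨z, hz⟩ := z
    set g := Finset.univ.gcd z with hg
    have hdvd : ∀ σ, g ∣ z σ := fun σ => Finset.gcd_dvd (Finset.mem_univ σ)
    by_cases h0 : g = 0
    · have : (fun σ => z σ / g) = 0 := by ext σ; simp [h0]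
      rw [this]
      exact Submodule.zero_mem _
    · have hz' : g • (fun σ => z σ / g) = z := by
        ext σ
        simpa using Int.mul_ediv_cancel' (hdvd σ)
      rw [← hz'] at hz
      have h1 : g • (X.boundary k).mulVecLin (fun σ => z σ / g) = 0 := by
        rw [← map_smul]
        exact hz
      exact (smul_eq_zero.mp h1).resolve_left h0⟩

/-- The winding number `w(z) = det([z]_Z, [∂̄_{i+1}]_Z)` of `z ∈ Z_i(X)`, where `Z` is a basis of
`Z_i(X)` and the columns `β` of `∂̄_{i+1}` form a basis of the lattice `B_i(X) = im ∂_{i+1}`. -/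
noncomputable def windingNumber {i m : ℕ} (Z : Basis (Fin (m + 1)) ℤ (X.cycles (i + 1)))
    (β : Basis (Fin m) ℤ (X.boundaries (i + 1))) (z : X.cycles (i + 1)) : ℤ :=
  (Matrix.of fun r c => Z.repr
    ((Fin.cons z fun j => ⟨(β j).1, X.boundaries_le_cycles (i + 1) (β j).2⟩ :
      Fin (m + 1) → X.cycles (i + 1)) c) r).det

end FinCellComplex

/-! ### Ranks and indices of lattices -/

/-! Every quantity in the identity is an index of lattices, with infinite index read as 0. Write C,
Z, B for C_i(U), Z_i(X), B_i(X). Applying ∂_i gives wt(U) = [C_i : C + Z] · |H̃_{i-1}(X)|.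
Projecting onto the cells outside U gives wt(T*) = [C_i : B + C] (`dualWeight_eq_index`), and this
equals [Z : B + C ∩ Z] · [C_i : C + Z] (`Submodule.index_sup_eq_mul`). If wt(U) ≠ 0, then C ∩ Z is
generated by Ĉ_U, so the factor [Z : B + C ∩ Z] is |w(Ĉ_U)|, and the second equality follows. If
wt(U) = 0, both of its sides vanish.

The first equality is C_U = wt(U) Ĉ_U together with linearity of w. It rests on
`exists_minorVec_eq_smul`: the maximal minors of an n × (n+1) integer matrix form a primitive vector
times the index of the column lattice.

The bijection is a rank count (`Unicycle.card_cell`), since complementation is an involution of 𝒮_i.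
-/

theorem LinearMap.finrank_range_add_finrank_ker_int {M N : Type*} [AddCommGroup M]
    [AddCommGroup N] [Module.Finite ℤ M] (f : M →ₗ[ℤ] N) :
    finrank ℤ (LinearMap.range f) + finrank ℤ (LinearMap.ker f) = finrank ℤ M := by
  rw [← f.quotKerEquivRange.finrank_eq]
  exact Submodule.finrank_quotient_add_finrank _

/-- Over ℤ, y ⬝ y = 0 forces y = 0, so AᵗA has the same kernel, hence the same rank, as A, while its
image lies in that of Aᵗ. -/
theorem Matrix.finrank_range_le_finrank_range_transpose {m n : Type*} [Fintype m] [Fintype n]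
    (A : Matrix m n ℤ) :
    finrank ℤ (LinearMap.range A.mulVecLin) ≤ finrank ℤ (LinearMap.range Aᵀ.mulVecLin) := by
  have hker : LinearMap.ker (Aᵀ * A).mulVecLin = LinearMap.ker A.mulVecLin := by
    ext x
    simp only [LinearMap.mem_ker, mulVecLin_apply, ← mulVec_mulVec]
    constructor
    · intro h
      have h1 : (A *ᵥ x) ⬝ᵥ (A *ᵥ x) = 0 := by
        rw [dotProduct_mulVec, vecMul_mulVec, ← mulVec_transpose, transpose_mul,
          transpose_transpose, ← mulVec_mulVec, h, zero_dotProduct]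
      exact dotProduct_self_eq_zero.1 h1
    · intro h
      rw [h, mulVec_zero]
  have h1 := LinearMap.finrank_range_add_finrank_ker_int A.mulVecLin
  have h2 := LinearMap.finrank_range_add_finrank_ker_int (Aᵀ * A).mulVecLin
  rw [hker] at h2
  have h3 : LinearMap.range (Aᵀ * A).mulVecLin ≤ LinearMap.range Aᵀ.mulVecLin := by
    rw [mulVecLin_mul]
    exact LinearMap.range_comp_le_range _ _
  have h4 := Submodule.finrank_mono h3
  omega

theorem Matrix.finrank_range_transpose_int {m n : Type*} [Fintype m] [Fintype n]
    (A : Matrix m n ℤ) :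
    finrank ℤ (LinearMap.range Aᵀ.mulVecLin) = finrank ℤ (LinearMap.range A.mulVecLin) :=
  le_antisymm (finrank_range_le_finrank_range_transpose Aᵀ)
    (finrank_range_le_finrank_range_transpose A)

theorem Submodule.index_map_int {M N : Type*} [AddCommGroup M] [AddCommGroup N]
    (f : M →ₗ[ℤ] N) (S : Submodule ℤ M) :
    (S.map f).toAddSubgroup.index =
      (S ⊔ LinearMap.ker f).toAddSubgroup.index * (LinearMap.range f).toAddSubgroup.index := by
  rw [Submodule.map_toAddSubgroup, Submodule.sup_toAddSubgroup, LinearMap.ker_toAddSubgroup,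
    LinearMap.range_toAddSubgroup]
  exact AddSubgroup.index_map _ _

theorem Submodule.index_map_of_surjective {M N : Type*} [AddCommGroup M] [AddCommGroup N]
    {f : M →ₗ[ℤ] N} (hf : Function.Surjective f) (S : Submodule ℤ M) :
    (S.map f).toAddSubgroup.index = (S ⊔ LinearMap.ker f).toAddSubgroup.index := by
  rw [Submodule.index_map_int, LinearMap.range_eq_top.2 hf, Submodule.top_toAddSubgroup,
    AddSubgroup.index_top, mul_one]

/-- Split the index at C + Z. The second isomorphism theorem turns [C + Z : B + C] into [Z : (B + C)
∩ Z], and the modular law rewrites (B + C) ∩ Z as B + C ∩ Z. -/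
theorem Submodule.index_sup_eq_mul {M : Type*} [AddCommGroup M] {B Z : Submodule ℤ M}
    (h : B ≤ Z) (C : Submodule ℤ M) :
    (B ⊔ C).toAddSubgroup.index =
      ((B ⊔ C ⊓ Z).submoduleOf Z).toAddSubgroup.index * (C ⊔ Z).toAddSubgroup.index := by
  have h1 : (B ⊔ C).toAddSubgroup ≤ (C ⊔ Z).toAddSubgroup :=
    sup_le (h.trans le_sup_right) le_sup_left
  rw [← AddSubgroup.relIndex_mul_index h1]
  congr 1
  have h2 : (C ⊔ Z).toAddSubgroup = Z.toAddSubgroup ⊔ (B ⊔ C).toAddSubgroup := by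
    rw [← Submodule.sup_toAddSubgroup]
    congr 1
    exact le_antisymm (sup_le (le_sup_right.trans le_sup_right) le_sup_left)
      (sup_le le_sup_right (sup_le (h.trans le_sup_right) le_sup_left))
  rw [h2, AddSubgroup.relIndex_sup_right, ← AddSubgroup.inf_relIndex_right]
  have h3 : (B ⊔ C).toAddSubgroup ⊓ Z.toAddSubgroup = (B ⊔ C ⊓ Z).toAddSubgroup := by
    rw [← sup_inf_assoc_of_le C h]
    rfl
  rw [h3]
  rfl

theorem Submodule.finrank_eq_of_index_ne_zero {M : Type*} [AddCommGroup M] [Module.Finite ℤ M]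
    [Module.Free ℤ M] {S : Submodule ℤ M} (h : S.toAddSubgroup.index ≠ 0) :
    finrank ℤ S = finrank ℤ M := by
  have : S.toAddSubgroup.FiniteIndex := ⟨h⟩
  exact AddSubgroup.finrank_eq_of_finiteIndex S.toAddSubgroup

/-- The index of the lattice spanned by as many vectors as the rank is the absolute value of
their determinant; both are zero if the vectors are dependent. -/
theorem Module.Basis.index_span_range {ι M : Type*} [Fintype ι] [DecidableEq ι] [AddCommGroup M]
    (b : Basis ι ℤ M) (v : ι → M) :
    (Submodule.span ℤ (Set.range v)).toAddSubgroup.index = (b.det v).natAbs := by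
  have : Module.Free ℤ M := Module.Free.of_basis b
  have : Module.Finite ℤ M := Module.Finite.of_basis b
  by_cases hv : LinearIndependent ℤ v
  · have h := Submodule.natAbs_det_basis_change b _ (Basis.span hv)
    have h' : ((↑) ∘ Basis.span hv : ι → M) = v := by
      ext j
      exact congrArg Subtype.val (Basis.span_apply hv j)
    rw [h'] at h
    exact h.symm
  · rw [b.det.map_linearDependent v hv, Int.natAbs_zero]
    -- A nonzero index would give the span full rank, so by rank-nullity no nontrivial relation
    -- could exist.
    by_contra hne
    apply hv
    have h1 := Submodule.finrank_eq_of_index_ne_zero hne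
    have h2 := LinearMap.finrank_range_add_finrank_ker_int (Fintype.linearCombination ℤ v)
    rw [Fintype.range_linearCombination, h1, finrank_eq_card_basis b, finrank_fintype_fun_eq_card,
      Nat.add_eq_left, Submodule.finrank_eq_zero] at h2
    refine Fintype.linearIndependent_iff.2 fun g hg => congrFun ?_
    rwa [← Fintype.linearCombination_apply, ← LinearMap.mem_ker, h2] at hg

theorem Matrix.index_range_mulVecLin {ι : Type*} [Fintype ι] [DecidableEq ι]
    (A : Matrix ι ι ℤ) : (LinearMap.range A.mulVecLin).toAddSubgroup.index = A.det.natAbs := by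
  rw [Matrix.range_mulVecLin, (Pi.basisFun ℤ ι).index_span_range, Pi.basisFun_det_apply]
  congr 1
  exact A.det_transpose

/-- The linear functionals given by a basis of the kernel of an integer matrix take all values. -/
theorem Matrix.exists_dotProduct_basis_ker {m n : Type*} [Fintype m] [Fintype n] {q : ℕ}
    (A : Matrix m n ℤ) (b : Basis (Fin q) ℤ (LinearMap.ker A.mulVecLin)) (y : Fin q → ℤ) :
    ∃ x : n → ℤ, ∀ r, (b r).1 ⬝ᵥ x = y r := by
  classical
  -- The image of A is free, so A splits onto it by a section s, and id - sA projects onto the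
  -- kernel.
  obtain ⟨s, hs⟩ := A.mulVecLin.rangeRestrict.exists_rightInverse_of_surjective
    (LinearMap.range_eq_top.2 A.mulVecLin.surjective_rangeRestrict)
  have hs' (z) : A.mulVecLin.rangeRestrict (s z) = z := LinearMap.congr_fun hs z
  let p : (n → ℤ) →ₗ[ℤ] LinearMap.ker A.mulVecLin :=
    (LinearMap.id - s ∘ₗ A.mulVecLin.rangeRestrict).codRestrict _ fun x => by
      have := congrArg Subtype.val (hs' (A.mulVecLin.rangeRestrict x))
      rw [LinearMap.mem_ker, LinearMap.sub_apply, map_sub]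
      exact sub_eq_zero.2 this.symm
  have hp (z : LinearMap.ker A.mulVecLin) : p z = z := by
    have : A.mulVecLin.rangeRestrict z = 0 := Subtype.ext z.2
    ext1
    simp [p, this]
  -- The functional prescribed on the basis extends along the projection; x lists its values on the
  -- unit vectors.
  let φ : (n → ℤ) →ₗ[ℤ] ℤ := (b.constr ℤ y : _ →ₗ[ℤ] ℤ) ∘ₗ p
  refine ⟨fun j => φ (Pi.single j 1), fun r => ?_⟩
  have h1 : φ (b r).1 = y r := by simp [φ, hp]
  rw [← h1, LinearMap.pi_apply_eq_sum_univ φ]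
  simp only [dotProduct, smul_eq_mul]
  refine Finset.sum_congr rfl fun j _ => ?_
  congr 2
  ext k
  simp [Pi.single_apply, eq_comm]

namespace FinCellComplex

/-! ### Maximal minors -/

/-- The minor without column j is the index of A(ker π), π being the j-th coordinate. That index is
[ℤⁿ : im A] times the index of ker π + ker A, and π identifies the latter with [ℤ : κ_j ℤ]. -/
theorem natAbs_minorVec {n : ℕ} (A : Matrix (Fin n) (Fin (n + 1)) ℤ) {κ : Fin (n + 1) → ℤ}
    (hκ : LinearMap.ker A.mulVecLin = Submodule.span ℤ {κ}) (j : Fin (n + 1)) :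
    (minorVec A j).natAbs =
      (LinearMap.range A.mulVecLin).toAddSubgroup.index * (κ j).natAbs := by
  have h1 : (minorVec A j).natAbs = (A.submatrix id j.succAbove).det.natAbs := by
    rw [minorVec, Int.natAbs_mul, Int.natAbs_pow]
    simp
  let π : (Fin (n + 1) → ℤ) →ₗ[ℤ] ℤ := LinearMap.proj j
  have hπ : Function.Surjective π := LinearMap.proj_surjective j
  have h2 : LinearMap.range (A.submatrix id j.succAbove).mulVecLin =
      (LinearMap.ker π).map A.mulVecLin := by
    ext y
    constructor
    · rintro ⟨x, rfl⟩
      refine ⟨j.insertNth 0 x, by simp [π], ?_⟩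
      ext r
      simp [mulVec, dotProduct, Fin.sum_univ_succAbove _ j]
    · rintro ⟨x, hx, rfl⟩
      refine ⟨fun k => x (j.succAbove k), ?_⟩
      have hx' : x j = 0 := hx
      ext r
      simp [mulVec, dotProduct, Fin.sum_univ_succAbove _ j, hx']
  have h3 : ((Submodule.span ℤ {κ}).map π).toAddSubgroup.index = (κ j).natAbs := by
    rw [Submodule.map_span, Set.image_singleton, ← Int.index_zmultiples]
    congr 1
    ext x
    simp [AddSubgroup.mem_zmultiples_iff, π]
  rw [h1, ← Matrix.index_range_mulVecLin, h2, Submodule.index_map_int, hκ, sup_comm,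
    ← Submodule.index_map_of_surjective hπ, h3, mul_comm]

/-- The vector of signed maximal minors is, up to the index of the lattice spanned by the columns,
a primitive vector, which generates the kernel if the rank is full. -/
theorem exists_minorVec_eq_smul {n : ℕ} (A : Matrix (Fin n) (Fin (n + 1)) ℤ) :
    ∃ κ : Fin (n + 1) → ℤ, Finset.univ.gcd κ = 1 ∧
      minorVec A = ((LinearMap.range A.mulVecLin).toAddSubgroup.index : ℤ) • κ ∧
      ((LinearMap.range A.mulVecLin).toAddSubgroup.index ≠ 0 →
        LinearMap.ker A.mulVecLin = Submodule.span ℤ {κ}) := by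
  set g := (LinearMap.range A.mulVecLin).toAddSubgroup.index with hg
  by_cases h0 : g = 0
  -- All minors vanish here, so any primitive vector serves.
  · refine ⟨fun _ => 1, ?_, ?_, fun h => absurd h0 h⟩
    · rw [← Finset.normalize_gcd]
      exact normalize_eq_one.2 (isUnit_of_dvd_one (Finset.gcd_dvd (Finset.mem_univ 0)))
    · ext j
      have h1 : (A.submatrix id j.succAbove).det.natAbs = 0 := by
        rw [← Matrix.index_range_mulVecLin]
        have hle : LinearMap.range (A.submatrix id j.succAbove).mulVecLin ≤
            LinearMap.range A.mulVecLin := by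
          rw [Matrix.range_mulVecLin, Matrix.range_mulVecLin]
          apply Submodule.span_mono
          rintro _ ⟨k, rfl⟩
          exact ⟨j.succAbove k, rfl⟩
        have := AddSubgroup.index_dvd_of_le (Submodule.toAddSubgroup_mono hle)
        rw [← hg, h0] at this
        exact zero_dvd_iff.1 this
      rw [Int.natAbs_eq_zero] at h1
      simp [minorVec, h1, h0]
  · have hr := Submodule.finrank_eq_of_index_ne_zero h0
    have hk := LinearMap.finrank_range_add_finrank_ker_int A.mulVecLin
    rw [hr, finrank_fintype_fun_eq_card, finrank_fintype_fun_eq_card, Fintype.card_fin,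
      Fintype.card_fin, add_right_inj] at hk
    obtain ⟨⟨κ, hκ⟩, hκ0, hspan⟩ := finrank_eq_one_iff'.1 hk
    have hκ0' : κ ≠ 0 := fun h => hκ0 (Subtype.ext h)
    have hker : LinearMap.ker A.mulVecLin = Submodule.span ℤ {κ} := by
      ext x
      rw [Submodule.mem_span_singleton]
      constructor
      · intro hx
        obtain ⟨c, hc⟩ := hspan ⟨x, hx⟩
        exact ⟨c, congrArg Subtype.val hc⟩
      · rintro ⟨c, rfl⟩
        exact Submodule.smul_mem _ c hκ
    -- The kernel is saturated: κ divided by its gcd lies in it again, hence is a multiple of κ.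
    have hgcd : Finset.univ.gcd κ = 1 := by
      obtain ⟨κ', hκ', hgcd'⟩ := Finset.extract_gcd κ (Finset.univ_nonempty)
      have hfac : κ = Finset.univ.gcd κ • κ' := by
        ext j
        exact hκ' j (Finset.mem_univ j)
      have hd : Finset.univ.gcd κ ≠ 0 := by
        intro h
        rw [h, zero_smul] at hfac
        exact hκ0' hfac
      have hmem : κ' ∈ LinearMap.ker A.mulVecLin := by
        rw [hfac, LinearMap.mem_ker, map_smul] at hκ
        exact (smul_eq_zero.1 hκ).resolve_left hd
      rw [hker, Submodule.mem_span_singleton] at hmem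
      obtain ⟨c, hc⟩ := hmem
      have h1 : (Finset.univ.gcd κ * c - 1) • κ = 0 := by
        rw [sub_smul, one_smul, mul_smul, hc, ← hfac, sub_self]
      have h2 := (smul_eq_zero.1 h1).resolve_right hκ0'
      have h3 : IsUnit (Finset.univ.gcd κ) := .of_mul_eq_one c (by linarith)
      rw [← Finset.normalize_gcd]
      exact normalize_eq_one.2 h3
    have hmem : minorVec A ∈ LinearMap.ker A.mulVecLin := mulVec_minorVec A
    rw [hker, Submodule.mem_span_singleton] at hmem
    obtain ⟨c, hc⟩ := hmem
    -- One nonzero coordinate of κ determines the factor c up to sign; the sign is then absorbed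
    -- into κ.
    obtain ⟨j, hj⟩ := Function.ne_iff.1 hκ0'
    have hcg : c.natAbs = g := by
      have h1 := natAbs_minorVec A hker j
      rw [← hc, Pi.smul_apply, smul_eq_mul, Int.natAbs_mul] at h1
      exact Nat.eq_of_mul_eq_mul_right (Int.natAbs_pos.2 hj) h1
    rcases Int.natAbs_eq c with h | h
    · exact ⟨κ, hgcd, by rw [← hc, ← hcg, ← h], fun _ => hker⟩
    · refine ⟨-κ, ?_, by rw [← hc, ← hcg, smul_neg, ← neg_smul, ← h], fun _ => ?_⟩
      · rw [← hgcd]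
        have h1 : -κ = fun k => -1 * κ k := by
          ext k
          simp
        rw [h1, Finset.gcd_mul_left, normalize_eq_one.2 isUnit_one.neg, one_mul]
      · rw [hker]
        rw [← Set.neg_singleton, Submodule.span_neg]

variable {X : FinCellComplex.{u}}

/-! ### Chains on a set of cells -/

/-- The boundary map `C_i → Z_{i-1}`. -/
def boundaryMap (X : FinCellComplex.{u}) (i : ℕ) : X.Chain (i + 1) →ₗ[ℤ] X.cycles i :=
  (X.boundary i).mulVecLin.codRestrict _ fun c => X.boundaries_le_cycles i ⟨c, rfl⟩

theorem ker_boundaryMap (i : ℕ) : LinearMap.ker (X.boundaryMap i) = X.cycles (i + 1) :=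
  LinearMap.ker_codRestrict _ _ _

theorem map_boundaryMap (i : ℕ) (S : Submodule ℤ (X.Chain (i + 1))) :
    S.map (X.boundaryMap i) = (S.map (X.boundary i).mulVecLin).submoduleOf (X.cycles i) := by
  ext z
  constructor
  · rintro ⟨c, hc, rfl⟩
    exact ⟨c, hc, rfl⟩
  · rintro ⟨c, hc, h⟩
    exact ⟨c, hc, Subtype.ext h⟩

theorem range_boundaryMap (i : ℕ) :
    LinearMap.range (X.boundaryMap i) = (X.boundaries i).submoduleOf (X.cycles i) :=
  LinearMap.range_codRestrict _ _ _

theorem boundaryMap_single (i : ℕ) (σ : X.Cell i) (a : ℤ) :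
    X.boundaryMap i (Pi.single (toFace σ) a) = a • X.cellBoundary i σ := by
  ext τ
  simp [boundaryMap, cellBoundary, mul_comm]

/-- Extension by zero of an integer vector indexed by an enumeration of a set of cells. -/
def extendChain {i k : ℕ} {I : Set (X.Cell i)} (e : Fin k ≃ I) :
    (Fin k → ℤ) →ₗ[ℤ] X.Chain (i + 1) where
  toFun y := ∑ j, Pi.single (toFace (e j : X.Cell i)) (y j)
  map_add' y y' := by simp [Pi.single_add, Finset.sum_add_distrib]
  map_smul' a y := by
    simp only [Pi.smul_apply, Pi.single_smul, Finset.smul_sum, RingHom.id_apply]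

theorem extendChain_apply_mem {i k : ℕ} {I : Set (X.Cell i)} (e : Fin k ≃ I) (y : Fin k → ℤ)
    (j : Fin k) : extendChain e y (toFace (e j : X.Cell i)) = y j := by
  simp only [extendChain, LinearMap.coe_mk, AddHom.coe_mk, Finset.sum_apply]
  rw [Finset.sum_eq_single j]
  · simp
  · intro l _ hl
    refine Pi.single_eq_of_ne (fun h => hl ?_) _
    exact (e.injective (Subtype.ext h)).symm
  · simp

theorem extendChain_apply_notMem {i k : ℕ} {I : Set (X.Cell i)} (e : Fin k ≃ I) (y : Fin k → ℤ)
    {σ : X.Cell i} (hσ : σ ∉ I) : extendChain e y (toFace σ) = 0 := by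
  simp only [extendChain, LinearMap.coe_mk, AddHom.coe_mk, Finset.sum_apply]
  refine Finset.sum_eq_zero fun l _ => Pi.single_eq_of_ne (fun h => hσ ?_) _
  have h' : σ = e l := h
  exact h' ▸ (e l).2

theorem extendChain_restrict {i k : ℕ} {I : Set (X.Cell i)} (e : Fin k ≃ I)
    {x : X.Chain (i + 1)} (hx : ∀ σ : X.Cell i, σ ∉ I → x (toFace σ) = 0) :
    extendChain e (fun j => x (toFace (e j : X.Cell i))) = x := by
  funext σ
  change X.Cell i at σ
  change extendChain e _ (toFace σ) = x (toFace σ)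
  by_cases hσ : σ ∈ I
  · obtain ⟨j, hj⟩ := e.surjective ⟨σ, hσ⟩
    have hj' : (e j : X.Cell i) = σ := congrArg Subtype.val hj
    rw [← hj', extendChain_apply_mem]
  · rw [extendChain_apply_notMem e _ hσ, hx σ hσ]

theorem range_extendChain {i k : ℕ} {U : X.Subcomplex} (e : Fin k ≃ U.cells i) :
    LinearMap.range (extendChain e) = U.chains (i + 1) := by
  ext x
  constructor
  · rintro ⟨y, rfl⟩ σ hσ
    exact extendChain_apply_notMem e y hσ
  · intro hx
    exact ⟨_, extendChain_restrict e hx⟩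

theorem gcd_extendChain {i k : ℕ} {I : Set (X.Cell i)} (e : Fin k ≃ I) (y : Fin k → ℤ) :
    Finset.univ.gcd (extendChain e y) = Finset.univ.gcd y := by
  refine dvd_antisymm_of_normalize_eq Finset.normalize_gcd Finset.normalize_gcd ?_ ?_
  · refine Finset.dvd_gcd fun j _ => ?_
    rw [← extendChain_apply_mem e y j]
    exact Finset.gcd_dvd (Finset.mem_univ _)
  · refine Finset.dvd_gcd fun σ _ => ?_
    change X.Cell i at σ
    change _ ∣ extendChain e y (toFace σ)
    by_cases hσ : σ ∈ I
    · obtain ⟨j, hj⟩ := e.surjective ⟨σ, hσ⟩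
      have hj' : (e j : X.Cell i) = σ := congrArg Subtype.val hj
      rw [← hj', extendChain_apply_mem]
      exact Finset.gcd_dvd (Finset.mem_univ _)
    · rw [extendChain_apply_notMem e _ hσ]
      exact dvd_zero _

theorem boundaryMatrix_mulVecLin {i n k : ℕ} (Z : Basis (Fin n) ℤ (X.cycles i))
    {I : Set (X.Cell i)} (e : Fin k ≃ I) :
    (boundaryMatrix Z e).mulVecLin =
      (Z.equivFun : X.cycles i →ₗ[ℤ] Fin n → ℤ) ∘ₗ X.boundaryMap i ∘ₗ extendChain e := by
  refine LinearMap.ext fun y => ?_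
  simp only [LinearMap.comp_apply, extendChain, LinearMap.coe_mk, AddHom.coe_mk, map_sum,
    boundaryMap_single]
  ext r
  simp [boundaryMatrix, mulVec, dotProduct, mul_comm]

/-! ### The weight of a cycletree -/

theorem Subcomplex.chains_eq_top {i : ℕ} {U : X.Subcomplex} (hU : X.skeletonLT i ≤ U) :
    U.chains i = ⊤ := by
  cases i with
  | zero => rfl
  | succ k =>
    rw [eq_top_iff]
    exact fun x _ σ hσ => absurd (hU k (Nat.lt_succ_self k)) hσ

theorem Subcomplex.cycles_eq {i : ℕ} {U : X.Subcomplex} (hU : X.skeletonLT i ≤ U) :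
    U.cycles i = X.cycles i := by
  rw [Subcomplex.cycles, chains_eq_top hU, inf_top_eq]

/-- Since U contains the (i-1)-skeleton, its (i-1)-cycles are those of X. The conventions for an
infinite quotient and an infinite index agree: both give 0. -/
theorem Subcomplex.weight_eq_index {i : ℕ} {U : X.Subcomplex} (hU : X.skeletonLT i ≤ U) :
    U.weight i = ((U.chains (i + 1)).map (X.boundaryMap i)).toAddSubgroup.index := by
  rw [map_boundaryMap, Subcomplex.weight, Subcomplex.Homology, cycles_eq hU]
  rfl

theorem card_homology_eq_index (i : ℕ) :
    Nat.card (X.Homology i) = (LinearMap.range (X.boundaryMap i)).toAddSubgroup.index := by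
  rw [range_boundaryMap]
  rfl

theorem index_range_boundaryMatrix {i n k : ℕ} {U : X.Subcomplex} (hU : X.skeletonLT i ≤ U)
    (Z : Basis (Fin n) ℤ (X.cycles i)) (e : Fin k ≃ U.cells i) :
    (LinearMap.range (boundaryMatrix Z e).mulVecLin).toAddSubgroup.index = U.weight i := by
  rw [boundaryMatrix_mulVecLin, LinearMap.range_comp, LinearMap.range_comp, range_extendChain,
    Submodule.index_map_of_surjective Z.equivFun.surjective, Subcomplex.weight_eq_index hU]
  simp

/-- The column lattice of the boundary matrix has index wt(U), so the minors are wt(U) times a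
primitive κ. For wt(U) ≠ 0 division by the gcd recovers κ, which spans the relations among the
columns, that is, the cycles supported on U. -/
theorem cyclePart_eq_smul_primitivePart {i n : ℕ} {U : X.Subcomplex} (hU : X.skeletonLT i ≤ U)
    (Z : Basis (Fin n) ℤ (X.cycles i)) (e : Fin (n + 1) ≃ U.cells i) :
    cyclePart Z e = (U.weight i : ℤ) • primitivePart (cyclePart Z e) ∧
      (U.weight i ≠ 0 → U.chains (i + 1) ⊓ X.cycles (i + 1) =
        Submodule.span ℤ {(primitivePart (cyclePart Z e)).1}) := by
  obtain ⟨κ, hgcd, hsmul, hker⟩ := exists_minorVec_eq_smul (boundaryMatrix Z e)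
  rw [index_range_boundaryMatrix hU] at hsmul hker
  have hval : (cyclePart Z e).1 = (U.weight i : ℤ) • extendChain e κ := by
    rw [← map_smul, ← hsmul]
    rfl
  by_cases h0 : U.weight i = 0
  · refine ⟨Subtype.ext ?_, fun h => absurd h0 h⟩
    rw [hval, h0]
    simp
  · have h0' : (U.weight i : ℤ) ≠ 0 := Int.natCast_ne_zero.2 h0
    have hg : Finset.univ.gcd (cyclePart Z e).1 = (U.weight i : ℤ) := by
      rw [hval, ← map_smul, gcd_extendChain]
      have h1 : (U.weight i : ℤ) • κ = fun j => (U.weight i : ℤ) * κ j := rfl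
      rw [h1, Finset.gcd_mul_left, hgcd, mul_one, Int.normalize_of_nonneg (Int.natCast_nonneg _)]
    have hprim : (primitivePart (cyclePart Z e)).1 = extendChain e κ := by
      funext σ
      change (cyclePart Z e).1 σ / Finset.univ.gcd (cyclePart Z e).1 = _
      rw [hg, hval, Pi.smul_apply, smul_eq_mul, Int.mul_ediv_cancel_left _ h0']
    refine ⟨Subtype.ext ?_, fun _ => ?_⟩
    · rw [hval, ← hprim]
      rfl
    · have hmap : (LinearMap.ker (boundaryMatrix Z e).mulVecLin).map (extendChain e) =
          U.chains (i + 1) ⊓ X.cycles (i + 1) := by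
        rw [boundaryMatrix_mulVecLin, LinearEquiv.ker_comp, LinearMap.ker_comp, ker_boundaryMap,
          Submodule.map_comap_eq, range_extendChain]
      rw [← hmap, hker h0, Submodule.map_span, Set.image_singleton, hprim]

/-! ### Winding numbers and dual weights as indices -/

theorem windingNumber_smul {i m : ℕ} (Z : Basis (Fin (m + 1)) ℤ (X.cycles (i + 1)))
    (β : Basis (Fin m) ℤ (X.boundaries (i + 1))) (a : ℤ) (z : X.cycles (i + 1)) :
    windingNumber Z β (a • z) = a * windingNumber Z β z := by
  have h (z : X.cycles (i + 1)) : windingNumber Z β z = Z.det (Fin.cons z fun j =>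
    ⟨(β j).1, X.boundaries_le_cycles (i + 1) (β j).2⟩) := rfl
  rw [h, h]
  exact Z.det.map_vecCons_smul _ a z

/-- The columns of the determinant span B_i + ℤz inside Z_i. -/
theorem natAbs_windingNumber {i m : ℕ} (Z : Basis (Fin (m + 1)) ℤ (X.cycles (i + 1)))
    (β : Basis (Fin m) ℤ (X.boundaries (i + 1))) (z : X.cycles (i + 1)) :
    (windingNumber Z β z).natAbs = ((X.boundaries (i + 1) ⊔ Submodule.span ℤ {z.1}).submoduleOf
      (X.cycles (i + 1))).toAddSubgroup.index := by
  refine (Z.index_span_range _).symm.trans ?_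
  congr 2
  -- Both lattices are compared inside C_i, where the columns from β span B_i itself.
  refine Submodule.map_injective_of_injective (X.cycles (i + 1)).subtype_injective ?_
  rw [Submodule.map_span, Fin.range_cons, Set.image_insert_eq, Submodule.submoduleOf,
    Submodule.map_comap_subtype, inf_eq_right.2, Submodule.span_insert, sup_comm]
  · congr 1
    have h := congrArg (Submodule.map (X.boundaries (i + 1)).subtype) β.span_eq
    rw [Submodule.map_span, Submodule.map_subtype_top] at h
    refine Eq.trans ?_ h
    rw [← Set.range_comp, ← Set.range_comp]
    rfl
  · exact sup_le (X.boundaries_le_cycles _) (by simp)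

/-- Restriction of chains to an enumerated set of cells. -/
def restrictChain {i k : ℕ} {I : Set (X.Cell i)} (e : Fin k ≃ I) :
    X.Chain (i + 1) →ₗ[ℤ] (Fin k → ℤ) :=
  LinearMap.funLeft ℤ ℤ fun j => toFace (e j : X.Cell i)

theorem restrictChain_surjective {i k : ℕ} {I : Set (X.Cell i)} (e : Fin k ≃ I) :
    Function.Surjective (restrictChain e) := fun y =>
  ⟨extendChain e y, funext fun j => extendChain_apply_mem e y j⟩

theorem ker_restrictChain {i k : ℕ} (U : X.Subcomplex) (e : Fin k ≃ (U.complement i).cells i) :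
    LinearMap.ker (restrictChain e) = U.chains (i + 1) := by
  have hmem (σ : X.Cell i) : σ ∈ (U.complement i).cells i ↔ σ ∉ U.cells i := by
    simp [Subcomplex.complement]
  ext x
  constructor
  · intro hx σ hσ
    obtain ⟨j, hj⟩ := e.surjective ⟨σ, (hmem σ).2 hσ⟩
    have hj' : (e j : X.Cell i) = σ := congrArg Subtype.val hj
    rw [← hj']
    exact congrFun hx j
  · intro hx
    exact funext fun j => hx _ ((hmem _).1 (e j).2)

/-- The σ-coordinate of ∂x is δσ ⬝ x. Expanding δσ in the basis of cocycles factors the restricted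
boundary map through x ↦ (Z_r ⬝ x)_r, which is onto ℤ^q because the cocycle lattice is a kernel. -/
theorem map_restrictChain_boundaries {i q : ℕ} (Z : Basis (Fin q) ℤ (X.cocycles (i + 2)))
    {I : Set (X.Cell i)} (e : Fin q ≃ I) :
    (X.boundaries (i + 1)).map (restrictChain e) = LinearMap.range
      (Matrix.of fun r c => Z.repr (X.cellCoboundary i (e c)) r)ᵀ.mulVecLin := by
  have key (x : X.Chain (i + 2)) : restrictChain e ((X.boundary (i + 1)).mulVecLin x) =
      (Matrix.of fun r c => Z.repr (X.cellCoboundary i (e c)) r)ᵀ.mulVecLin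
        fun r => (Z r).1 ⬝ᵥ x := by
    ext j
    have h := congrArg Subtype.val (Z.sum_repr (X.cellCoboundary i (e j)))
    have h' : (X.cellCoboundary i (e j)).1 ⬝ᵥ x =
        (X.boundary (i + 1) *ᵥ x) (toFace (e j : X.Cell i)) := rfl
    simp only [restrictChain, LinearMap.funLeft_apply, mulVecLin_apply]
    rw [← h', ← h]
    rw [Submodule.coe_sum, sum_dotProduct]
    simp only [Submodule.coe_smul, smul_dotProduct]
    rfl
  ext y
  constructor
  · rintro ⟨_, ⟨x, rfl⟩, rfl⟩
    exact ⟨_, (key x).symm⟩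
  · rintro ⟨y, rfl⟩
    obtain ⟨x, hx⟩ := Matrix.exists_dotProduct_basis_ker _ Z y
    refine ⟨_, ⟨x, rfl⟩, (key x).trans ?_⟩
    congr 1
    exact funext hx

/-- Restriction to the cells outside U is onto with kernel C_i(U), so the index of B_i + C_i(U) is
that of the image of B_i, the row lattice of the matrix M of coboundary coordinates. -/
theorem dualWeight_eq_index {i q : ℕ} (U : X.Subcomplex) (Z : Basis (Fin q) ℤ (X.cocycles (i + 2)))
    (e : Fin q ≃ (U.complement i).cells i) :
    dualWeight Z e = ((X.boundaries (i + 1) ⊔ U.chains (i + 1)).toAddSubgroup.index : ℤ) := by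
  rw [← ker_restrictChain U e, ← Submodule.index_map_of_surjective (restrictChain_surjective e),
    map_restrictChain_boundaries Z, Matrix.index_range_mulVecLin, det_transpose, dualWeight,
    Int.natCast_natAbs]

/-! ### Counting cells -/

theorem finrank_homology_add (k : ℕ) :
    finrank ℤ (X.Homology k) + finrank ℤ (X.boundaries k) = finrank ℤ (X.cycles k) := by
  rw [← (Submodule.submoduleOfEquivOfLe (X.boundaries_le_cycles k)).finrank_eq]
  exact Submodule.finrank_quotient_add_finrank _

/-- |X_i| = rk B_{i-1} + rk Z_i. The homology conditions give rk B_{i-1} = rk Z_{i-1}, rk Z_i = rk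
B_i + 1 and rk Z_{i+1} = rk B_{i+1}; the last yields rk B_i = rk C_{i+1} - rk B_{i+1} = rk Z^{i+1}.
-/
theorem Unicycle.card_cell {i : ℕ} (hX : X.Unicycle i) :
    Fintype.card (X.Cell i) = finrank ℤ (X.cycles i) + 1 + finrank ℤ (X.cocycles (i + 2)) := by
  obtain ⟨h1, h2, h3⟩ := hX
  have a1 := X.finrank_homology_add (i + 2)
  have a2 := X.finrank_homology_add (i + 1)
  have a3 := X.finrank_homology_add i
  have b1 : finrank ℤ (X.boundaries i) + finrank ℤ (X.cycles (i + 1)) = Fintype.card (X.Cell i) :=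
    ((X.boundary i).mulVecLin.finrank_range_add_finrank_ker_int).trans
      (finrank_fintype_fun_eq_card ℤ)
  have b2 : finrank ℤ (X.boundaries (i + 1)) + finrank ℤ (X.cycles (i + 2)) =
      finrank ℤ (X.Chain (i + 2)) :=
    (X.boundary (i + 1)).mulVecLin.finrank_range_add_finrank_ker_int
  have b3 : finrank ℤ (X.boundaries (i + 2)) + finrank ℤ (X.cocycles (i + 2)) =
      finrank ℤ (X.Chain (i + 2)) := by
    rw [boundaries, ← Matrix.finrank_range_transpose_int]
    exact (X.boundary (i + 2))ᵀ.mulVecLin.finrank_range_add_finrank_ker_int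
  omega

theorem Subcomplex.complement_mem (i : ℕ) (U : X.Subcomplex) :
    U.complement i ∈ X.spanningSubcomplexes i :=
  ⟨fun _ _ h => Or.inl h, fun _ _ h => by rcases h with h | ⟨h, -⟩ <;> simp [skeletonLT] <;> omega⟩

theorem Subcomplex.complement_complement {i : ℕ} {U : X.Subcomplex}
    (hU : U ∈ X.spanningSubcomplexes i) : (U.complement i).complement i = U := by
  ext k σ
  have h1 : k < i → σ ∈ U.cells k := fun h => hU.1 k h
  have h2 : σ ∈ U.cells k → k < i + 1 := fun h => hU.2 k h
  simp only [Subcomplex.complement, Set.mem_ofPred_eq]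
  rcases lt_trichotomy k i with h | h | h
  · simp [h, h1 h]
  · simp [h]
  · have : ¬ k < i + 1 := by omega
    simp [h.ne', h.not_gt, mt h2 this]

theorem Subcomplex.ncard_add_ncard_complement (i : ℕ) (U : X.Subcomplex) :
    (U.cells i).ncard + ((U.complement i).cells i).ncard = Fintype.card (X.Cell i) := by
  have h : (U.complement i).cells i = (U.cells i)ᶜ := by
    ext σ
    simp [Subcomplex.complement]
  rw [h, Set.ncard_add_ncard_compl, Nat.card_eq_fintype_card]

theorem bijOn_complement {i : ℕ} (hX : X.Unicycle i) :
    Set.BijOn (Subcomplex.complement i) (X.cycletrees i) (X.dualSpanningTrees i) := by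
  have hc := hX.card_cell
  refine ⟨fun U hU => ⟨U.complement_mem i, ?_⟩, fun U hU V hV h => ?_, fun T hT =>
    ⟨T.complement i, ⟨T.complement_mem i, ?_⟩, Subcomplex.complement_complement hT.1⟩⟩
  · have h1 := U.ncard_add_ncard_complement i
    have h2 := hU.2
    omega
  · rw [← Subcomplex.complement_complement hU.1, ← Subcomplex.complement_complement hV.1]
    exact congrArg _ h
  · have h1 := T.ncard_add_ncard_complement i
    have h2 := hT.2
    omega

/-! ### The weight identity -/

theorem weight_mul_windingNumber_primitivePart {i n m q : ℕ} {U : X.Subcomplex}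
    (hU : X.skeletonLT i ≤ U) (Z₁ : Basis (Fin n) ℤ (X.cycles i)) (e : Fin (n + 1) ≃ U.cells i)
    (Z₂ : Basis (Fin (m + 1)) ℤ (X.cycles (i + 1))) (β : Basis (Fin m) ℤ (X.boundaries (i + 1)))
    (Z₃ : Basis (Fin q) ℤ (X.cocycles (i + 2))) (e' : Fin q ≃ (U.complement i).cells i) :
    (U.weight i : ℤ) * |windingNumber Z₂ β (primitivePart (cyclePart Z₁ e))| =
      dualWeight Z₃ e' * (Nat.card (X.Homology i) : ℤ) := by
  have hw : U.weight i = (U.chains (i + 1) ⊔ X.cycles (i + 1)).toAddSubgroup.index *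
      Nat.card (X.Homology i) := by
    rw [Subcomplex.weight_eq_index hU, Submodule.index_map_int, ker_boundaryMap,
      card_homology_eq_index]
  -- The factor [C_i : C_i(U) + Z_i] of the dual weight combines with |H̃_{i-1}(X)| to give wt(U).
  rw [dualWeight_eq_index, Submodule.index_sup_eq_mul (X.boundaries_le_cycles (i + 1)),
    Nat.cast_mul, mul_assoc, ← Nat.cast_mul, ← hw]
  by_cases h0 : U.weight i = 0
  · simp [h0]
  · rw [(cyclePart_eq_smul_primitivePart hU Z₁ e).2 h0, ← natAbs_windingNumber Z₂ β,
      Int.natCast_natAbs, mul_comm]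

end FinCellComplex

theorem mainTheorem3 (X : FinCellComplex.{u}) (i : ℕ) (hX : X.Unicycle i) :
    Set.BijOn (FinCellComplex.Subcomplex.complement i) (X.cycletrees i) (X.dualSpanningTrees i) ∧
    ∀ U ∈ X.cycletrees i,
      -- a basis of `Z_{i-1}(X)` and an enumeration of `I(U)`, which define `C_U`
      ∀ (n : ℕ) (Z₁ : Module.Basis (Fin n) ℤ (X.cycles i)) (e : Fin (n + 1) ≃ U.cells i)
      -- bases of `Z_i(X)` and `B_i(X)`, which define `w`
        (m : ℕ) (Z₂ : Module.Basis (Fin (m + 1)) ℤ (X.cycles (i + 1)))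
        (β : Module.Basis (Fin m) ℤ (X.boundaries (i + 1)))
      -- a basis of `Z^{i+1}(X)` and an enumeration of the complement of `I(U)`, which define
      -- the weight of the dual spanning tree
        (q : ℕ) (Z₃ : Module.Basis (Fin q) ℤ (X.cocycles (i + 2)))
        (e' : Fin q ≃ (U.complement i).cells i),
        |FinCellComplex.windingNumber Z₂ β (FinCellComplex.cyclePart Z₁ e)| =
          (U.weight i : ℤ) * |FinCellComplex.windingNumber Z₂ β
            (FinCellComplex.primitivePart (FinCellComplex.cyclePart Z₁ e))| ∧
        (U.weight i : ℤ) * |FinCellComplex.windingNumber Z₂ β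
            (FinCellComplex.primitivePart (FinCellComplex.cyclePart Z₁ e))| =
          FinCellComplex.dualWeight Z₃ e' * (Nat.card (X.Homology i) : ℤ) := by
  refine ⟨FinCellComplex.bijOn_complement hX, fun U hU n Z₁ e m Z₂ β q Z₃ e' => ⟨?_,
    FinCellComplex.weight_mul_windingNumber_primitivePart hU.1.1 Z₁ e Z₂ β Z₃ e'⟩⟩
  -- Only the left side is rewritten, since C_U also occurs on the right, inside Ĉ_U.
  conv_lhs => rw [(FinCellComplex.cyclePart_eq_smul_primitivePart hU.1.1 Z₁ e).1,
    FinCellComplex.windingNumber_smul, abs_mul, Nat.abs_cast]
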